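/- Let $n\ge 1$ and let $(X_1,\ldots,X_n)$ be an exchangeable sequence of $\{0,1\}$-valued random variables on a probability space $(\Omega,\mathscr F,\mathrm P)$, i.e. its joint law is invariant under all permutations of the indices. For $i=0,1,\ldots,n$ put $$x_i=\mathrm P(X_1=\cdots=X_i=0,\;X_{i+1}=\cdots=X_n=1).$$ Define the real Hankel matrices $H_n=(h_{i,j})$ and $K_n=(k_{i,j})$ as follows. If $n$ is even, $$h_{i,j}=\sum_{k=0}^{n+2-i-j}\binom{n+2-i-j}{k}x_k\quad\Big(1\le i,j\le \tfrac{n+2}{2}\Big),\qquad k_{i,j}=\sum_{k=0}^{n-i-j}\binom{n-i-j}{k}x_{k+1}\quad\Big(1\le i,j\le \tfrac n2\Big);$$ if $n$ is odd, $$h_{i,j}=\sum_{k=0}^{n+1-i-j}\binom{n+1-i-j}{k}x_k,\qquad k_{i,j}=\sum_{k=0}^{n+1-i-j}\binom{n+1-i-j}{k}x_{k+1}\quad\Big(1\le i,j\le \tfrac{n+1}{2}\Big).$$ Then the joint law of $(X_1,\ldots,X_n)$ is a true mixture of i.i.d. laws, i.e. there is a (nonnegative) probability measure $\mu$ on the space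 $\mathcal P(\{0,1\})$ of probability measures on $\{0,1\}$, with the $\sigma$-algebra generated by the maps $\nu\mapsto\nu(B)$, $B\subseteq\{0,1\}$, such that $$\mathrm P\big((X_1,\ldots,X_n)\in A\big)=\int_{\mathcal P(\{0,1\})}\nu^{n}(A)\,\mu(\mathrm d\nu)\qquad\text{for all }A\subseteq\{0,1\}^n,$$ if and only if $H_n$ and $K_n$ are both positive semi-definite. -/

import Mathlib

open MeasureTheory

namespace FiniteExchangeable

variable {Ω S : Type*} [MeasurableSpace Ω] [MeasurableSpace S]

/-- The joint law of `(X 0, …, X (n-1))` is invariant under all permutations of the indices. -/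
def Exchangeable {n : ℕ} (P : Measure Ω) (X : Fin n → Ω → S) : Prop :=
  ∀ σ : Equiv.Perm (Fin n),
    P.map (fun ω i => X (σ i) ω) = P.map (fun ω i => X i ω)

/-- A law `ρ` on `S ^ n` is a true mixture of i.i.d. laws: `ρ A = ∫ ν ^ n (A) μ(dν)` for all
measurable `A`, with a (nonnegative) probability measure `μ` on the space of probability measures
on `S`, which carries the σ-algebra generated by the maps `ν ↦ ν B`. -/
def IsTrueMixture {n : ℕ} (ρ : Measure (Fin n → S)) : Prop :=
  ∃ μ : Measure (ProbabilityMeasure S), IsProbabilityMeasure μ ∧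
    ∀ A : Set (Fin n → S), MeasurableSet A →
      ρ A = ∫⁻ ν, Measure.pi (fun _ : Fin n => (ν : Measure S)) A ∂μ

/-- `x i = P (X_1 = ⋯ = X_i = 0, X_{i+1} = ⋯ = X_n = 1)`; the variable `X_{j+1}` is `X j`. -/
noncomputable def x {n : ℕ} (P : Measure Ω) (X : Fin n → Ω → Fin 2) (i : ℕ) : ℝ :=
  P.real {ω | ∀ j : Fin n, (j.val < i → X j ω = 0) ∧ (i ≤ j.val → X j ω = 1)}

/-- The matrix `H_n` of a sequence `x`. The row and column numbers of the entry at `(a, b)`,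
counted from one, are `i = a + 1` and `j = b + 1`. The dimension `n / 2 + 1` is `(n + 2) / 2` for
even `n` and `(n + 1) / 2` for odd `n`. -/
noncomputable def H (n : ℕ) (x : ℕ → ℝ) : Matrix (Fin (n / 2 + 1)) (Fin (n / 2 + 1)) ℝ :=
  Matrix.of fun a b =>
    let i : ℕ := a + 1
    let j : ℕ := b + 1
    if Even n then
      ∑ k ∈ Finset.range (n + 2 - i - j + 1), ((n + 2 - i - j).choose k : ℝ) * x k
    else
      ∑ k ∈ Finset.range (n + 1 - i - j + 1), ((n + 1 - i - j).choose k : ℝ) * x k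

/-- The matrix `K_n` of a sequence `x`, with the same indexing. The dimension `(n + 1) / 2` is
`n / 2` for even `n`. -/
noncomputable def K (n : ℕ) (x : ℕ → ℝ) : Matrix (Fin ((n + 1) / 2)) (Fin ((n + 1) / 2)) ℝ :=
  Matrix.of fun a b =>
    let i : ℕ := a + 1
    let j : ℕ := b + 1
    if Even n then
      ∑ k ∈ Finset.range (n - i - j + 1), ((n - i - j).choose k : ℝ) * x (k + 1)
    else
      ∑ k ∈ Finset.range (n + 1 - i - j + 1), ((n + 1 - i - j).choose k : ℝ) * x (k + 1)

end FiniteExchangeable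

/-!
Write `s` for the probability of the symbol `1`. Under a mixture of i.i.d. laws, a word with
`k` zeros has probability `x k = ∫ s ^ (n - k) * (1 - s) ^ k`, and the binomial theorem turns the
entries of `H n x` and `K n x` into the integrals of `s ^ (a + b + ε)` and
`s ^ (a + b + 1 - ε) * (1 - s)`, where `ε = n % 2`. The claim is thus the truncated Hausdorff moment
problem on `[0, 1]`.

For any `x` there is a linear functional `L` on `ℝ[X]` with `L (X ^ (n - k) * (1 - X) ^ k) = x k` for
`k ≤ n` (`exists_functional_apply_eq`). The two matrices are positive semidefinite exactly when `L` is
nonnegative on all `X ^ a * (1 - X) ^ b * q ^ 2` of formal degree at most `n`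
(`posSemidef_iff_nonnegOnSquares`); integration functionals clearly are, which settles one direction.

Conversely, such an `L` is nonnegative on every polynomial of degree at most `n` that is nonnegative
on `(0, 1)` (`NonnegOnSquares.nonneg_of_nonneg`, a dual form of the Markov–Lukács theorem). The proof
splits off real roots outside `(0, 1)`, double roots inside, and pairs of conjugate complex roots,
each time moving the factor from the polynomial into the functional. The moment vectors of
probability measures on `[0, 1]` form a compact convex set, so if the moments of `L` lay outside it,
a separating hyperplane would be a polynomial contradicting this positivity
(`exists_integralEval_eq`). The representing measure on `[0, 1]`, carried over to the space of laws on
`Fin 2` by `coinLaw`, is the mixing measure; exchangeability and the case of single words determine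
the whole law.
-/

namespace FiniteExchangeable

open MeasureTheory Polynomial
open scoped unitInterval

/-! ### Nonnegative polynomials on the unit interval -/

/-- `L` is nonnegative on the products `X ^ a * (1 - X) ^ b * q ^ 2` whose formal degree
`a + b + 2 * q.natDegree` is at most `n`. -/
def NonnegOnSquares (n : ℕ) (L : ℝ[X] →ₗ[ℝ] ℝ) : Prop :=
  ∀ (a b : ℕ) (q : ℝ[X]), a + b + 2 * q.natDegree ≤ n → 0 ≤ L (X ^ a * (1 - X) ^ b * q ^ 2)

/-- Multiplication by a linear polynomial that is nonnegative on `[0, 1]`, written in the Bernstein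
basis `X`, `1 - X`, lowers the degree bound by one. -/
theorem NonnegOnSquares.mul_linear {n : ℕ} {L : ℝ[X] →ₗ[ℝ] ℝ} (hL : NonnegOnSquares (n + 1) L)
    {α β : ℝ} (hα : 0 ≤ α) (hβ : 0 ≤ β) :
    NonnegOnSquares n (L ∘ₗ LinearMap.mulLeft ℝ (C α * X + C β * (1 - X))) := by
  intro a b q h
  have h1 := hL (a + 1) b q (by omega)
  have h2 := hL a (b + 1) q (by omega)
  have : (C α * X + C β * (1 - X)) * (X ^ a * (1 - X) ^ b * q ^ 2)
      = α • (X ^ (a + 1) * (1 - X) ^ b * q ^ 2) + β • (X ^ a * (1 - X) ^ (b + 1) * q ^ 2) := by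
    simp only [smul_eq_C_mul]; ring
  rw [LinearMap.comp_apply, LinearMap.mulLeft_apply, this, map_add, map_smul, map_smul]
  exact add_nonneg (mul_nonneg hα h1) (mul_nonneg hβ h2)

theorem NonnegOnSquares.mul_quadratic {n : ℕ} {L : ℝ[X] →ₗ[ℝ] ℝ}
    (hL : NonnegOnSquares (n + 2) L) (r t : ℝ) :
    NonnegOnSquares n (L ∘ₗ LinearMap.mulLeft ℝ ((X - C r) ^ 2 + C t ^ 2)) := by
  intro a b q h
  have hd : ((X - C r) * q).natDegree ≤ 1 + q.natDegree :=
    natDegree_mul_le.trans (by rw [natDegree_X_sub_C])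
  have hd' : (C t * q).natDegree ≤ q.natDegree := natDegree_C_mul_le _ _
  have h1 := hL a b ((X - C r) * q) (by omega)
  have h2 := hL a b (C t * q) (by omega)
  have : ((X - C r) ^ 2 + C t ^ 2) * (X ^ a * (1 - X) ^ b * q ^ 2)
      = X ^ a * (1 - X) ^ b * ((X - C r) * q) ^ 2 + X ^ a * (1 - X) ^ b * (C t * q) ^ 2 := by
    ring
  rw [LinearMap.comp_apply, LinearMap.mulLeft_apply, this, map_add]
  exact add_nonneg h1 h2

theorem eval_eq_zero_of_X_sub_C_mul_nonneg {p q : ℝ[X]} {a : ℝ} (ha : a ∈ Set.Ioo (0 : ℝ) 1)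
    (hpq : p = (X - C a) * q) (hp : ∀ s ∈ Set.Ioo (0 : ℝ) 1, 0 ≤ p.eval s) : q.eval a = 0 := by
  have hI : Set.Ioo (0 : ℝ) 1 ∈ nhds a := isOpen_Ioo.mem_nhds ha
  have hq : ∀ s ∈ Set.Ioo (0 : ℝ) 1, 0 ≤ (s - a) * q.eval s := fun s hs => by
    simpa [hpq] using hp s hs
  apply le_antisymm
  · refine le_of_tendsto (q.continuous.continuousAt.mono_left (nhdsWithin_le_nhds (s := Set.Iio a)))
      ?_
    filter_upwards [nhdsWithin_le_nhds hI, self_mem_nhdsWithin] with s hs hsa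
    exact nonpos_of_mul_nonneg_right (hq s hs) (sub_neg.2 hsa)
  · refine ge_of_tendsto (q.continuous.continuousAt.mono_left (nhdsWithin_le_nhds (s := Set.Ioi a)))
      ?_
    filter_upwards [nhdsWithin_le_nhds hI, self_mem_nhdsWithin] with s hs hsa
    exact nonneg_of_mul_nonneg_right (hq s hs) (sub_pos.2 hsa)

theorem nonneg_of_sq_mul_nonneg {p q : ℝ[X]} {a : ℝ}
    (hpq : p = (X - C a) ^ 2 * q) (hp : ∀ s ∈ Set.Ioo (0 : ℝ) 1, 0 ≤ p.eval s) :
    ∀ s ∈ Set.Ioo (0 : ℝ) 1, 0 ≤ q.eval s := by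
  have key : ∀ s ∈ Set.Ioo (0 : ℝ) 1, s ≠ a → 0 ≤ q.eval s := fun s hs hsa =>
    nonneg_of_mul_nonneg_right (by simpa [hpq] using hp s hs) (sq_pos_of_ne_zero (sub_ne_zero.2 hsa))
  intro s hs
  rcases ne_or_eq s a with hsa | rfl
  · exact key s hs hsa
  · refine ge_of_tendsto
      (q.continuous.continuousAt.mono_left (nhdsWithin_le_nhds (s := {s}ᶜ))) ?_
    filter_upwards [nhdsWithin_le_nhds (isOpen_Ioo.mem_nhds hs), self_mem_nhdsWithin] with u hu hus
    exact key u hu hus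

theorem exists_quadratic_factor {p : ℝ[X]} (hp : p.natDegree ≠ 0) (hroot : ∀ a, p.eval a ≠ 0) :
    ∃ r t : ℝ, t ≠ 0 ∧ (X - C r) ^ 2 + C t ^ 2 ∣ p := by
  obtain ⟨z, hz⟩ := IsAlgClosed.exists_aeval_eq_zero ℂ p
    (fun h => hp (natDegree_eq_of_degree_eq_some (by simpa using h)))
  have him : z.im ≠ 0 := by
    intro h0
    have hzr : z = algebraMap ℝ ℂ z.re := Complex.ext (by simp) (by simp [h0])
    rw [hzr, aeval_algebraMap_apply] at hz
    exact hroot z.re (by simpa using hz)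
  refine ⟨z.re, z.im, him, ?_⟩
  convert! p.quadratic_dvd_of_aeval_eq_zero_im_ne_zero hz him using 1
  rw [← Complex.normSq_eq_norm_sq, Complex.normSq_apply]
  simp only [map_mul, map_add, map_ofNat]
  ring

/-- A dual form of the Markov–Lukács theorem. The induction is on the degree of `p`, with `L` general:
a factor of `p` that is nonnegative on `(0, 1)` is absorbed into `L`. -/
theorem NonnegOnSquares.nonneg_of_nonneg {n : ℕ} {L : ℝ[X] →ₗ[ℝ] ℝ} (hL : NonnegOnSquares n L)
    {p : ℝ[X]} (hn : p.natDegree ≤ n) (hp : ∀ s ∈ Set.Ioo (0 : ℝ) 1, 0 ≤ p.eval s) : 0 ≤ L p := by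
  induction hd : p.natDegree using Nat.strong_induction_on generalizing n L p with
  | _ d ih =>
  subst hd
  by_cases h0 : p.natDegree = 0
  · obtain ⟨c, rfl⟩ := natDegree_eq_zero.1 h0
    have hc : 0 ≤ c := by simpa using hp (1 / 2) ⟨by norm_num, by norm_num⟩
    simpa [← C_pow, Real.sq_sqrt hc] using hL 0 0 (C √c) (by simp)
  have hp0 : p ≠ 0 := fun h => h0 (by simp [h])
  -- Dividing `p` by a factor `f` moves `f` into the functional.
  have step : ∀ (f q : ℝ[X]) (k : ℕ), p = f * q → f.natDegree = k → 0 < k →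
      (∀ m, n = m + k → NonnegOnSquares m (L ∘ₗ LinearMap.mulLeft ℝ f)) →
      (∀ s ∈ Set.Ioo (0 : ℝ) 1, 0 ≤ q.eval s) → 0 ≤ L p := by
    intro f q k hpq hfk hk hf hq
    have hdeg : p.natDegree = k + q.natDegree := by
      rw [hpq, natDegree_mul (left_ne_zero_of_mul (hpq ▸ hp0)) (right_ne_zero_of_mul (hpq ▸ hp0)),
        hfk]
    have := ih q.natDegree (by omega) (hf (n - k) (by omega)) (by omega) hq rfl
    rwa [LinearMap.comp_apply, LinearMap.mulLeft_apply, ← hpq] at this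
  have hquad : ∀ r t : ℝ, ((X - C r) ^ 2 + C t ^ 2).natDegree = 2 := fun r t => by
    rw [← C_pow, natDegree_add_C, natDegree_pow, natDegree_X_sub_C]
  by_cases hroot : ∃ a, p.eval a = 0
  · obtain ⟨a, ha⟩ := hroot
    obtain ⟨q, hpq⟩ := dvd_iff_isRoot.2 ha
    rcases le_or_gt a 0 with ha0 | ha0
    · have hf : X - C a = C (1 - a) * X + C (-a) * (1 - X) := by simp; ring
      refine step _ q 1 hpq (natDegree_X_sub_C a) one_pos ?_ fun s hs => ?_
      · rintro m rfl
        rw [hf]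
        exact hL.mul_linear (by linarith) (by linarith)
      · exact nonneg_of_mul_nonneg_right (by simpa [hpq] using hp s hs)
          (show 0 < s - a by linarith [hs.1])
    rcases le_or_gt 1 a with ha1 | ha1
    · have hf : C a - X = C (a - 1) * X + C a * (1 - X) := by simp; ring
      refine step (C a - X) (-q) 1 (by rw [hpq]; ring) ?_ one_pos ?_ fun s hs => ?_
      · rw [← natDegree_neg, neg_sub, natDegree_X_sub_C]
      · rintro m rfl
        rw [hf]
        exact hL.mul_linear (by linarith) (by linarith)
      · refine nonneg_of_mul_nonneg_right (a := a - s) ?_ (by linarith [hs.2])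
        have := hp s hs
        simp only [hpq, eval_mul, eval_sub, eval_X, eval_C] at this
        rw [eval_neg]
        linarith
    · -- An interior root is a double root, since `p` does not change sign there.
      obtain ⟨q', rfl⟩ := dvd_iff_isRoot.2 (eval_eq_zero_of_X_sub_C_mul_nonneg ⟨ha0, ha1⟩ hpq hp)
      have hpq' : p = (X - C a) ^ 2 * q' := by rw [hpq]; ring
      refine step ((X - C a) ^ 2 + C 0 ^ 2) q' 2 (by rw [hpq']; simp) (hquad _ _) two_pos ?_
        (nonneg_of_sq_mul_nonneg hpq' hp)
      rintro m rfl
      exact hL.mul_quadratic a 0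
  · push Not at hroot
    obtain ⟨r, t, ht, q, hpq⟩ := exists_quadratic_factor h0 hroot
    refine step _ q 2 hpq (hquad _ _) two_pos ?_ fun s hs => ?_
    · rintro m rfl
      exact hL.mul_quadratic r t
    · exact nonneg_of_mul_nonneg_right (by simpa [hpq] using hp s hs)
        (show 0 < (s - r) ^ 2 + t ^ 2 by positivity)

/-! ### Hankel matrices and linear functionals -/

/-- The value forced on `X ^ m * (1 - X) ^ j`, for `m + j ≤ n`, by giving `X ^ (n - k) * (1 - X) ^ k`
the value `x k` for all `k ≤ n`: expand after multiplying by `(X + (1 - X)) ^ (n - m - j)`. -/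
noncomputable def bernsteinValue (n : ℕ) (x : ℕ → ℝ) (m j : ℕ) : ℝ :=
  ∑ k ∈ Finset.range (n - m - j + 1), ((n - m - j).choose k : ℝ) * x (k + j)

theorem H_apply (n : ℕ) (x : ℕ → ℝ) (a b : Fin (n / 2 + 1)) :
    H n x a b = bernsteinValue n x (n % 2 + (a + b)) 0 := by
  rcases Nat.even_or_odd n with h | h
  · have h2 := Nat.even_iff.1 h
    have e : n + 2 - (a.val + 1) - (b.val + 1) = n - (n % 2 + (a + b)) - 0 := by omega
    simp only [H, bernsteinValue, Matrix.of_apply, if_pos h, e, add_zero]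
  · have h2 := Nat.odd_iff.1 h
    have e : n + 1 - (a.val + 1) - (b.val + 1) = n - (n % 2 + (a + b)) - 0 := by omega
    simp only [H, bernsteinValue, Matrix.of_apply, if_neg (Nat.not_even_iff_odd.2 h), e, add_zero]

theorem K_apply (n : ℕ) (x : ℕ → ℝ) (a b : Fin ((n + 1) / 2)) :
    K n x a b = bernsteinValue n x (1 - n % 2 + (a + b)) 1 := by
  rcases Nat.even_or_odd n with h | h
  · have h2 := Nat.even_iff.1 h
    have e : n - (a.val + 1) - (b.val + 1) = n - (1 - n % 2 + (a + b)) - 1 := by omega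
    simp only [K, bernsteinValue, Matrix.of_apply, if_pos h, e]
  · have h2 := Nat.odd_iff.1 h
    have e : n + 1 - (a.val + 1) - (b.val + 1) = n - (1 - n % 2 + (a + b)) - 1 := by omega
    simp only [K, bernsteinValue, Matrix.of_apply, if_neg (Nat.not_even_iff_odd.2 h), e]

/-- Pascal's rule; the counterpart of
`X ^ m * (1 - X) ^ (j + 1) = X ^ m * (1 - X) ^ j - X ^ (m + 1) * (1 - X) ^ j`. -/
theorem bernsteinValue_succ {n : ℕ} (x : ℕ → ℝ) {m j : ℕ} (h : m + (j + 1) ≤ n) :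
    bernsteinValue n x m (j + 1) = bernsteinValue n x m j - bernsteinValue n x (m + 1) j := by
  obtain ⟨d, rfl⟩ := Nat.exists_eq_add_of_le h
  have e1 : m + (j + 1) + d - m - (j + 1) = d := by omega
  have e2 : m + (j + 1) + d - m - j = d + 1 := by omega
  have e3 : m + (j + 1) + d - (m + 1) - j = d := by omega
  simp only [bernsteinValue, e1, e2, e3]
  rw [Finset.sum_range_succ' _ (d + 1), eq_sub_iff_add_eq]
  simp only [Nat.choose_succ_succ, Nat.cast_add, add_mul, Finset.sum_add_distrib]
  rw [Finset.sum_range_succ (fun k => ((d.choose (k + 1) : ℕ) : ℝ) * x (k + 1 + j)),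
    Finset.sum_range_succ' (fun k => (d.choose k : ℝ) * x (k + j)) d]
  simp [add_assoc, add_comm 1 j]

theorem exists_functional_apply_eq (n : ℕ) (x : ℕ → ℝ) :
    ∃ L : ℝ[X] →ₗ[ℝ] ℝ, ∀ m j, m + j ≤ n → L (X ^ m * (1 - X) ^ j) = bernsteinValue n x m j := by
  refine ⟨(basisMonomials ℝ).constr ℝ fun m => bernsteinValue n x m 0, fun m j => ?_⟩
  induction j generalizing m with
  | zero =>
    intro _
    rw [pow_zero, mul_one, X_pow_eq_monomial, ← congrFun (coe_basisMonomials (R := ℝ)) m,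
      Module.Basis.constr_basis]
  | succ j ih =>
    intro h
    rw [bernsteinValue_succ x h, ← ih m (by omega), ← ih (m + 1) (by omega), ← map_sub]
    congr 1
    ring

theorem apply_eq_bernsteinValue {n : ℕ} {x : ℕ → ℝ} {L : ℝ[X] →ₗ[ℝ] ℝ}
    (hL : ∀ k ≤ n, L (X ^ (n - k) * (1 - X) ^ k) = x k) {m j : ℕ} (h : m + j ≤ n) :
    L (X ^ m * (1 - X) ^ j) = bernsteinValue n x m j := by
  have : (X : ℝ[X]) ^ m * (1 - X) ^ j = ∑ k ∈ Finset.range (n - m - j + 1),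
      ((n - m - j).choose k : ℝ) • (X ^ (n - (k + j)) * (1 - X) ^ (k + j)) := by
    have h1 : (X : ℝ[X]) ^ m * (1 - X) ^ j
        = X ^ m * (1 - X) ^ j * ((1 - X) + X) ^ (n - m - j) := by
      rw [sub_add_cancel, one_pow, mul_one]
    rw [h1, add_pow, Finset.mul_sum]
    refine Finset.sum_congr rfl fun k hk => ?_
    have hk' : k ≤ n - m - j := Nat.lt_succ_iff.1 (Finset.mem_range.1 hk)
    have e : n - (k + j) = m + (n - m - j - k) := by omega
    rw [smul_eq_C_mul, C_eq_natCast, e]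
    ring
  rw [this, map_sum, bernsteinValue]
  refine Finset.sum_congr rfl fun k hk => ?_
  have hk' : k ≤ n - m - j := Nat.lt_succ_iff.1 (Finset.mem_range.1 hk)
  rw [map_smul, hL _ (by omega), smul_eq_mul]

/-- The quadratic form of the Hankel matrix `L (f * X ^ (a + b))` at the coefficient vector of `q` is
`L (f * q ^ 2)`. -/
theorem posSemidef_iff_of_apply_eq {N : ℕ} {A : Matrix (Fin N) (Fin N) ℝ} {L : ℝ[X] →ₗ[ℝ] ℝ}
    {f : ℝ[X]} (hA : ∀ a b, A a b = L (f * X ^ (a + b : ℕ))) :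
    A.PosSemidef ↔ ∀ q : ℝ[X], q.natDegree < N → 0 ≤ L (f * q ^ 2) := by
  have hherm : A.IsHermitian := by
    ext a b
    simp [hA, add_comm]
  have hform : ∀ v : Fin N → ℝ,
      star v ⬝ᵥ A.mulVec v = L (f * (∑ a : Fin N, C (v a) * X ^ (a : ℕ)) ^ 2) := by
    intro v
    rw [sq, Finset.sum_mul_sum, Finset.mul_sum, map_sum]
    refine Finset.sum_congr rfl fun a _ => ?_
    rw [Matrix.mulVec, dotProduct, Finset.mul_sum, Finset.mul_sum, map_sum]
    refine Finset.sum_congr rfl fun b _ => ?_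
    have : f * (C (v a) * X ^ (a : ℕ) * (C (v b) * X ^ (b : ℕ)))
        = (v a * v b) • (f * X ^ (a + b : ℕ)) := by
      rw [smul_eq_C_mul, C_mul]; ring
    rw [this, map_smul, hA, smul_eq_mul, Pi.star_apply, star_trivial]
    ring
  rw [Matrix.posSemidef_iff_dotProduct_mulVec, and_iff_right hherm]
  constructor
  · intro h q hq
    have := h fun a => q.coeff a
    rwa [hform, Fin.sum_univ_eq_sum_range (fun i => C (q.coeff i) * X ^ i),
      ← q.as_sum_range_C_mul_X_pow' hq] at this
  · intro h v
    rw [hform]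
    rcases Nat.eq_zero_or_pos N with rfl | hN
    · simp
    · refine h _ (lt_of_le_of_lt (natDegree_sum_le_of_forall_le (n := N - 1) _ _ fun a _ => ?_)
        (Nat.sub_lt hN one_pos))
      exact (natDegree_C_mul_X_pow_le _ _).trans (by omega)

/-- The two matrices only give the exponents `a`, `b` of one parity class: `a = n % 2`, `b = 0` and
`a = 1 - n % 2`, `b = 1`. The others follow by absorbing even powers into `q` and by using
`1 = X + (1 - X)` when the parity of `a + b` is not that of `n`. -/
theorem posSemidef_iff_nonnegOnSquares {n : ℕ} {x : ℕ → ℝ} {L : ℝ[X] →ₗ[ℝ] ℝ}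
    (hL : ∀ m j, m + j ≤ n → L (X ^ m * (1 - X) ^ j) = bernsteinValue n x m j) :
    (H n x).PosSemidef ∧ (K n x).PosSemidef ↔ NonnegOnSquares n L := by
  rw [posSemidef_iff_of_apply_eq (A := H n x) (L := L) (f := X ^ (n % 2)) fun a b => by
      rw [H_apply, ← hL _ _ (by omega), pow_zero, mul_one, pow_add],
    posSemidef_iff_of_apply_eq (A := K n x) (L := L) (f := X ^ (1 - n % 2) * (1 - X))
      fun a b => by
        rw [K_apply, ← hL _ _ (by omega), pow_one, pow_add]
        congr 1
        ring]
  constructor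
  · rintro ⟨hH, hK⟩
    suffices key : ∀ a < 2, ∀ b < 2, ∀ q : ℝ[X], a + b + 2 * q.natDegree ≤ n →
        0 ≤ L (X ^ a * (1 - X) ^ b * q ^ 2) by
      intro a b q h
      have hX : (1 - X : ℝ[X]).natDegree ≤ 1 := by compute_degree
      have hd : (X ^ (a / 2) * (1 - X) ^ (b / 2) * q).natDegree
          ≤ a / 2 + b / 2 + q.natDegree := by
        refine natDegree_mul_le.trans (add_le_add_left (natDegree_mul_le.trans ?_) _)
        refine add_le_add (natDegree_X_pow_le _) (natDegree_pow_le.trans ?_)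
        simpa using Nat.mul_le_mul_left (b / 2) hX
      have := key (a % 2) (Nat.mod_lt _ two_pos) (b % 2) (Nat.mod_lt _ two_pos) _
        (show a % 2 + b % 2 + 2 * (X ^ (a / 2) * (1 - X) ^ (b / 2) * q).natDegree ≤ n by omega)
      convert! this using 2
      nth_rewrite 1 [← Nat.mod_add_div a 2, ← Nat.mod_add_div b 2]
      ring
    -- If `a + b` has the parity of `n`, the claim is one of the hypotheses; otherwise there is
    -- room for one more degree, and `1 = X + (1 - X)` is inserted.
    have hdX : ∀ q : ℝ[X], (X * q).natDegree ≤ 1 + q.natDegree := fun q =>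
      natDegree_mul_le.trans (add_le_add_left natDegree_X_le _)
    have hdX' : ∀ q : ℝ[X], ((1 - X) * q).natDegree ≤ 1 + q.natDegree := fun q =>
      natDegree_mul_le.trans (add_le_add_left (by compute_degree) _)
    intro a ha b hb q h
    have h1 := hdX q
    have h2 := hdX' q
    rcases Nat.mod_two_eq_zero_or_one n with hn | hn <;> simp only [hn] at hH hK <;>
      interval_cases a <;> interval_cases b
    · simpa using hH q (by omega)
    · convert! add_nonneg (hH ((1 - X) * q) (by omega)) (hK q (by omega)) using 1
      rw [← map_add]; congr 1; ring
    · convert! add_nonneg (hH (X * q) (by omega)) (hK q (by omega)) using 1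
      rw [← map_add]; congr 1; ring
    · simpa using hK q (by omega)
    · convert! add_nonneg (hH q (by omega)) (hK q (by omega)) using 1
      rw [← map_add]; congr 1; ring
    · simpa using hK q (by omega)
    · simpa using hH q (by omega)
    · convert! add_nonneg (hH ((1 - X) * q) (by omega)) (hK (X * q) (by omega)) using 1
      rw [← map_add]; congr 1; ring
  · intro h
    refine ⟨fun q hq => ?_, fun q hq => ?_⟩
    · simpa using h (n % 2) 0 q (by omega)
    · simpa using h (1 - n % 2) 1 q (by omega)

/-! ### The truncated Hausdorff moment problem -/

theorem integrable_eval (m : Measure I) [IsFiniteMeasure m] (p : ℝ[X]) :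
    Integrable (fun s : I => p.eval (s : ℝ)) m :=
  (p.continuous.comp continuous_subtype_val).integrable_of_hasCompactSupport
    (HasCompactSupport.of_compactSpace _)

/-- Integration of polynomial functions against a finite measure on `[0, 1]`. -/
noncomputable def integralEval (m : Measure I) [IsFiniteMeasure m] : ℝ[X] →ₗ[ℝ] ℝ where
  toFun p := ∫ s : I, p.eval (s : ℝ) ∂m
  map_add' p q := by
    simp only [eval_add]
    exact integral_add (integrable_eval m p) (integrable_eval m q)
  map_smul' c p := by
    simp only [eval_smul, RingHom.id_apply]
    exact integral_smul c _

theorem integralEval_apply (m : Measure I) [IsFiniteMeasure m] (p : ℝ[X]) :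
    integralEval m p = ∫ s : I, p.eval (s : ℝ) ∂m := rfl

theorem nonnegOnSquares_integralEval (n : ℕ) (m : Measure I) [IsFiniteMeasure m] :
    NonnegOnSquares n (integralEval m) := by
  intro a b q _
  refine integral_nonneg fun s => ?_
  have h0 := s.2.1
  have h1 : 0 ≤ 1 - (s : ℝ) := sub_nonneg.2 s.2.2
  simp only [eval_mul, eval_pow, eval_sub, eval_one, eval_X]
  positivity

/-- The moments of orders `0, …, n` of a probability measure on `[0, 1]`. -/
noncomputable def momentVector (n : ℕ) (m : ProbabilityMeasure I) : Fin (n + 1) → ℝ :=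
  fun k => integralEval (m : Measure I) (X ^ (k : ℕ))

theorem isCompact_range_momentVector (n : ℕ) : IsCompact (Set.range (momentVector n)) := by
  refine isCompact_range (continuous_pi fun k => ?_)
  have := ProbabilityMeasure.continuous_integral_continuousMap
    (⟨fun s : I => (s : ℝ) ^ (k : ℕ), by fun_prop⟩ : C(I, ℝ))
  simpa [momentVector, integralEval_apply] using this

theorem convex_range_momentVector (n : ℕ) : Convex ℝ (Set.range (momentVector n)) := by
  rintro _ ⟨m₁, rfl⟩ _ ⟨m₂, rfl⟩ a b ha hb hab
  have hm : IsProbabilityMeasure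
      (ENNReal.ofReal a • (m₁ : Measure I) + ENNReal.ofReal b • (m₂ : Measure I)) :=
    ⟨by simp [← ENNReal.ofReal_add ha hb, hab]⟩
  refine ⟨⟨_, hm⟩, funext fun k => ?_⟩
  have h1 := (integrable_eval (m₁ : Measure I) (X ^ (k : ℕ))).smul_measure
    (ENNReal.ofReal_ne_top (r := a))
  have h2 := (integrable_eval (m₂ : Measure I) (X ^ (k : ℕ))).smul_measure
    (ENNReal.ofReal_ne_top (r := b))
  simp only [momentVector, integralEval_apply, ProbabilityMeasure.coe_mk, Pi.add_apply,
    Pi.smul_apply, smul_eq_mul]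
  rw [integral_add_measure h1 h2, integral_smul_measure, integral_smul_measure,
    ENNReal.toReal_ofReal ha, ENNReal.toReal_ofReal hb, smul_eq_mul, smul_eq_mul]

/-- The truncated moment problem on `[0, 1]`: a normalized functional that is nonnegative on the
polynomials of degree at most `n` that are nonnegative on `(0, 1)` is integration against a
probability measure, on polynomials of degree at most `n`. -/
theorem exists_integralEval_eq {n : ℕ} {L : ℝ[X] →ₗ[ℝ] ℝ} (h1 : L 1 = 1)
    (hL : ∀ p : ℝ[X], p.natDegree ≤ n → (∀ s ∈ Set.Ioo (0 : ℝ) 1, 0 ≤ p.eval s) → 0 ≤ L p) :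
    ∃ m : ProbabilityMeasure I, ∀ p : ℝ[X], p.natDegree ≤ n →
      L p = integralEval (m : Measure I) p := by
  have hmem : (fun k : Fin (n + 1) => L (X ^ (k : ℕ))) ∈ Set.range (momentVector n) := by
    by_contra hc
    obtain ⟨f, u, hfu, hf⟩ := geometric_hahn_banach_point_closed (convex_range_momentVector n)
      (isCompact_range_momentVector n).isClosed hc
    have hsum : ∀ v : Fin (n + 1) → ℝ, f v = ∑ k, v k * f (Pi.single k 1) := fun v => by
      conv_lhs => rw [← Finset.univ_sum_single v, map_sum]
      refine Finset.sum_congr rfl fun k _ => ?_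
      rw [← smul_eq_mul, ← map_smul, ← Pi.single_smul, smul_eq_mul, mul_one]
    have hp := hL ((∑ k : Fin (n + 1), C (f (Pi.single k 1)) * X ^ (k : ℕ)) - C u) ?_ ?_
    · rw [← mul_one (C u), ← smul_eq_C_mul, map_sub, map_smul, h1, map_sum] at hp
      simp only [← smul_eq_C_mul, map_smul] at hp
      rw [hsum] at hfu
      simp only [smul_eq_mul, mul_one, mul_comm (f _)] at hp
      linarith
    · refine (natDegree_sub_le _ _).trans (max_le ?_ (by simp))
      exact natDegree_sum_le_of_forall_le _ _ fun k _ =>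
        (natDegree_C_mul_X_pow_le _ _).trans (by omega)
    · -- The hyperplane, evaluated at the moment vector of the Dirac measure at `s`.
      intro s hs
      have := hf _ ⟨⟨Measure.dirac (⟨s, hs.1.le, hs.2.le⟩ : I), inferInstance⟩, rfl⟩
      rw [hsum] at this
      simp only [momentVector, integralEval_apply, ProbabilityMeasure.coe_mk,
        integral_dirac, eval_pow, eval_X] at this
      simp only [eval_sub, eval_finsetSum, eval_mul, eval_C, eval_pow, eval_X, mul_comm (f _)]
      linarith
  obtain ⟨m, hm⟩ := hmem
  refine ⟨m, fun p hp => ?_⟩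
  rw [p.as_sum_range_C_mul_X_pow' (Nat.lt_succ_of_le hp)]
  simp only [← smul_eq_C_mul, map_sum, map_smul]
  refine Finset.sum_congr rfl fun k hk => ?_
  rw [← congrFun hm ⟨k, Finset.mem_range.1 hk⟩]
  rfl

/-! ### Words in a Bernoulli sequence -/

/-- The number of zeros in a word. -/
def zeroCount {n : ℕ} (y : Fin n → Fin 2) : ℕ :=
  Fintype.card {i // y i = 0}

theorem zeroCount_le {n : ℕ} (y : Fin n → Fin 2) : zeroCount y ≤ n := by
  simpa [zeroCount] using Fintype.card_subtype_le fun i => y i = 0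

/-- The probability of the word `y` in independent trials, as a polynomial in the probability of the
symbol `1`. -/
noncomputable def wordPolynomial {n : ℕ} (y : Fin n → Fin 2) : ℝ[X] :=
  ∏ i, if y i = 0 then 1 - X else X

theorem wordPolynomial_eq {n : ℕ} (y : Fin n → Fin 2) :
    wordPolynomial y = X ^ (n - zeroCount y) * (1 - X) ^ zeroCount y := by
  have h : (Finset.univ.filter fun i => y i = 0).card = zeroCount y :=
    (Fintype.card_subtype _).symm
  have h' : (Finset.univ.filter fun i => ¬ y i = 0).card = n - zeroCount y := by
    have := Finset.card_filter_add_card_filter_not (s := Finset.univ) (fun i : Fin n => y i = 0)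
    rw [Finset.card_univ, Fintype.card_fin] at this
    omega
  rw [wordPolynomial, Finset.prod_ite, Finset.prod_const, Finset.prod_const, h, h', mul_comm]

theorem natDegree_wordPolynomial_le {n : ℕ} (y : Fin n → Fin 2) :
    (wordPolynomial y).natDegree ≤ n := by
  refine (natDegree_prod_le _ _).trans ?_
  refine (Finset.sum_le_card_nsmul _ _ 1 fun i _ => ?_).trans (by simp)
  split_ifs <;> compute_degree

/-- Expanding `∏ i, ((1 - X) + X) = 1`. -/
theorem sum_wordPolynomial (n : ℕ) : ∑ y : Fin n → Fin 2, wordPolynomial y = 1 := by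
  have := Finset.prod_univ_sum (fun _ : Fin n => (Finset.univ : Finset (Fin 2)))
    (fun _ j => if j = 0 then (1 - X : ℝ[X]) else X)
  simp only [Fintype.piFinset_univ] at this
  simp only [wordPolynomial]
  rw [← this]
  simp

/-- The mass that a law on `Fin 2` gives to the symbol `1`. -/
def successProbability (ν : ProbabilityMeasure (Fin 2)) : I :=
  ⟨(ν : Measure (Fin 2)).real {1}, measureReal_nonneg, measureReal_le_one⟩

theorem measurable_successProbability : Measurable successProbability :=
  (((Measure.measurable_coe (measurableSet_singleton 1)).comp
    measurable_subtype_coe).ennreal_toReal).subtype_mk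

/-- The law on `Fin 2` that gives mass `s` to the symbol `1`. -/
noncomputable def coinLaw (s : I) : ProbabilityMeasure (Fin 2) :=
  ⟨ProbabilityTheory.bernoulliMeasure 1 0 s, inferInstance⟩

theorem measurable_coinLaw : Measurable coinLaw := by
  refine Measurable.subtype_mk (Measure.measurable_of_measurable_coe _ fun A hA => ?_)
  classical
  simp only [ProbabilityTheory.bernoulliMeasure_apply _ hA]
  split_ifs <;> fun_prop

theorem successProbability_coinLaw (s : I) : successProbability (coinLaw s) = s := by
  ext
  simp [successProbability, coinLaw]

theorem prod_singleton_eq {n : ℕ} (ν : ProbabilityMeasure (Fin 2)) (y : Fin n → Fin 2) :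
    ∏ i, (ν : Measure (Fin 2)) {y i}
      = ENNReal.ofReal ((wordPolynomial y).eval (successProbability ν : ℝ)) := by
  have h0 : 0 ≤ (successProbability ν : ℝ) := (successProbability ν).2.1
  have h1 : 0 ≤ 1 - (successProbability ν : ℝ) := sub_nonneg.2 (successProbability ν).2.2
  rw [wordPolynomial, eval_prod, ENNReal.ofReal_prod_of_nonneg fun i _ => by
    split_ifs <;> simp [h0, h1, -sub_nonneg]]
  refine Finset.prod_congr rfl fun i _ => ?_
  generalize y i = j
  fin_cases j
  · have h : ({0} : Set (Fin 2)) = {1}ᶜ := by ext j; fin_cases j <;> simp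
    simp only [Fin.zero_eta, if_true, eval_sub, eval_one, eval_X, successProbability]
    rw [h, ← probReal_compl_eq_one_sub (measurableSet_singleton _), ofReal_measureReal]
  · simp [successProbability]

theorem wordPolynomial_eval_nonneg {n : ℕ} (y : Fin n → Fin 2) (s : I) :
    0 ≤ (wordPolynomial y).eval (s : ℝ) := by
  have h0 : 0 ≤ (s : ℝ) := s.2.1
  have h1 : 0 ≤ 1 - (s : ℝ) := sub_nonneg.2 s.2.2
  rw [wordPolynomial_eq]
  simp only [eval_mul, eval_pow, eval_sub, eval_one, eval_X]
  positivity

theorem measurable_ofReal_eval (p : ℝ[X]) :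
    Measurable fun s : I => ENNReal.ofReal (p.eval (s : ℝ)) :=
  (p.continuous.comp continuous_subtype_val).measurable.ennreal_ofReal

theorem measurable_ofReal_eval_successProbability (p : ℝ[X]) :
    Measurable fun ν => ENNReal.ofReal (p.eval (successProbability ν : ℝ)) :=
  (measurable_ofReal_eval p).comp measurable_successProbability

theorem isTrueMixture_iff_singleton {n : ℕ} (ρ : Measure (Fin n → Fin 2)) :
    IsTrueMixture ρ ↔ ∃ μ : Measure (ProbabilityMeasure (Fin 2)), IsProbabilityMeasure μ ∧
      ∀ y, ρ {y} = ∫⁻ ν, ENNReal.ofReal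
        ((wordPolynomial y).eval (successProbability ν : ℝ)) ∂μ := by
  refine exists_congr fun μ => and_congr_right fun _ => ⟨fun h y => ?_, fun h A _ => ?_⟩
  · rw [h _ (measurableSet_singleton y)]
    simp only [Measure.pi_singleton, prod_singleton_eq]
  · classical
    have hA : A = ((Set.toFinite A).toFinset : Set (Fin n → Fin 2)) := by simp
    rw [hA, ← sum_measure_singleton]
    simp only [← sum_measure_singleton, Measure.pi_singleton, prod_singleton_eq]
    rw [lintegral_finsetSum _ fun y _ => measurable_ofReal_eval_successProbability _]
    exact Finset.sum_congr rfl fun y _ => h y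

/-- Laws on `Fin 2` correspond to points of `[0, 1]`, measurably in both directions, so a mixing
measure may be sought on `[0, 1]`; since `Fin n → Fin 2` is finite, single words suffice. -/
theorem isTrueMixture_iff_exists_integralEval {n : ℕ} (ρ : Measure (Fin n → Fin 2))
    [IsFiniteMeasure ρ] :
    IsTrueMixture ρ ↔ ∃ m : ProbabilityMeasure I,
      ∀ y, ρ.real {y} = integralEval (m : Measure I) (wordPolynomial y) := by
  have key : ∀ (m : ProbabilityMeasure I) (y : Fin n → Fin 2),
      ρ.real {y} = integralEval (m : Measure I) (wordPolynomial y) ↔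
        ρ {y} = ∫⁻ s : I, ENNReal.ofReal ((wordPolynomial y).eval (s : ℝ)) ∂(m : Measure I) := by
    intro m y
    have hnn := wordPolynomial_eval_nonneg y
    rw [integralEval_apply, ← ofReal_integral_eq_lintegral_ofReal (integrable_eval _ _)
      (ae_of_all _ hnn), ← ofReal_measureReal,
      ENNReal.ofReal_eq_ofReal_iff measureReal_nonneg (integral_nonneg hnn)]
  simp only [isTrueMixture_iff_singleton, key]
  constructor
  · rintro ⟨μ, hμ, h⟩
    refine ⟨⟨μ.map successProbability,
      Measure.isProbabilityMeasure_map measurable_successProbability.aemeasurable⟩, fun y => ?_⟩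
    rw [h, ProbabilityMeasure.coe_mk,
      lintegral_map (measurable_ofReal_eval _) measurable_successProbability]
  · rintro ⟨m, h⟩
    refine ⟨(m : Measure I).map coinLaw,
      Measure.isProbabilityMeasure_map measurable_coinLaw.aemeasurable, fun y => ?_⟩
    rw [h, lintegral_map (measurable_ofReal_eval_successProbability _) measurable_coinLaw]
    simp only [successProbability_coinLaw]

/-! ### Exchangeable words -/

/-- The word of length `n` with `k` leading zeros followed by ones, for `k ≤ n`. -/
def sortedWord (n k : ℕ) : Fin n → Fin 2 := fun j => if j.val < k then 0 else 1

theorem zeroCount_sortedWord {n k : ℕ} (h : k ≤ n) : zeroCount (sortedWord n k) = k := by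
  simp [zeroCount, sortedWord, Fintype.card_subtype, Fin.card_filter_val_lt, h]

theorem exists_perm_comp_eq {n : ℕ} {y z : Fin n → Fin 2} (h : zeroCount y = zeroCount z) :
    ∃ τ : Equiv.Perm (Fin n), z ∘ τ = y := by
  let e := Fintype.equivOfCardEq h
  refine ⟨e.extendSubtype, funext fun i => ?_⟩
  by_cases hi : y i = 0
  · exact (e.extendSubtype_mem i hi).trans hi.symm
  · have := e.extendSubtype_not_mem i hi
    simp only [Function.comp_apply]
    omega

section Probability

variable {Ω : Type*} [MeasurableSpace Ω] {P : Measure Ω} {n : ℕ} {X : Fin n → Ω → Fin 2}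

theorem Exchangeable.map_singleton_comp (hexch : Exchangeable P X) (hX : ∀ i, Measurable (X i))
    (τ : Equiv.Perm (Fin n)) (z : Fin n → Fin 2) :
    P.map (fun ω i => X i ω) {z ∘ τ} = P.map (fun ω i => X i ω) {z} := by
  conv_lhs => rw [← hexch τ]
  rw [Measure.map_apply (measurable_pi_lambda _ fun i => hX (τ i)) (measurableSet_singleton _),
    Measure.map_apply (measurable_pi_lambda _ hX) (measurableSet_singleton _)]
  congr 1
  ext ω
  simp only [Set.mem_preimage, Set.mem_singleton_iff, funext_iff, Function.comp_apply]
  exact τ.forall_congr_left (p := fun i => X (τ i) ω = z (τ i)) |>.trans (by simp)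

theorem Exchangeable.map_real_singleton (hexch : Exchangeable P X) (hX : ∀ i, Measurable (X i))
    (y : Fin n → Fin 2) :
    (P.map (fun ω i => X i ω)).real {y} = x P X (zeroCount y) := by
  obtain ⟨τ, hτ⟩ := exists_perm_comp_eq (zeroCount_sortedWord (zeroCount_le y)).symm
  have h : (P.map (fun ω i => X i ω)).real {y}
      = (P.map (fun ω i => X i ω)).real {sortedWord n (zeroCount y)} := by
    rw [measureReal_def, measureReal_def, ← hexch.map_singleton_comp hX τ (sortedWord _ _), hτ]
  rw [h, map_measureReal_apply (measurable_pi_lambda _ hX) (measurableSet_singleton _), x]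
  congr 1
  ext ω
  simp only [Set.mem_preimage, Set.mem_singleton_iff, funext_iff, sortedWord, Set.mem_ofPred_eq]
  refine forall_congr' fun j => ?_
  by_cases hj : j.val < zeroCount y
  · simp [hj, Nat.not_le.2 hj]
  · simp [hj, Nat.le_of_not_lt hj]

theorem Exchangeable.isTrueMixture_map_iff [IsProbabilityMeasure P] (hexch : Exchangeable P X)
    (hX : ∀ i, Measurable (X i)) :
    IsTrueMixture (P.map (fun ω i => X i ω)) ↔
      (H n (x P X)).PosSemidef ∧ (K n (x P X)).PosSemidef := by
  have hprob : IsProbabilityMeasure (P.map (fun ω i => X i ω)) :=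
    Measure.isProbabilityMeasure_map (measurable_pi_lambda _ hX).aemeasurable
  rw [isTrueMixture_iff_exists_integralEval]
  constructor
  · rintro ⟨m, hm⟩
    refine (posSemidef_iff_nonnegOnSquares fun i j hij => apply_eq_bernsteinValue
      (L := integralEval (m : Measure I)) (fun k hk => ?_) hij).2
      (nonnegOnSquares_integralEval n _)
    have h := hm (sortedWord n k)
    rw [hexch.map_real_singleton hX, wordPolynomial_eq, zeroCount_sortedWord hk] at h
    exact h.symm
  · intro hHK
    obtain ⟨L, hL⟩ := exists_functional_apply_eq n (x P X)
    have hword : ∀ y : Fin n → Fin 2,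
        L (wordPolynomial y) = (P.map (fun ω i => X i ω)).real {y} := fun y => by
      have hy := zeroCount_le y
      rw [wordPolynomial_eq, hL _ _ (by omega), hexch.map_real_singleton hX]
      have e : n - (n - zeroCount y) - zeroCount y = 0 := by omega
      simp [bernsteinValue, e]
    have h1 : L 1 = 1 := by
      rw [← sum_wordPolynomial n, map_sum]
      simp only [hword]
      rw [sum_measureReal_singleton]
      simp
    have hpos := (posSemidef_iff_nonnegOnSquares hL).1 hHK
    obtain ⟨m, hm⟩ := exists_integralEval_eq h1 fun p hp => hpos.nonneg_of_nonneg hp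
    exact ⟨m, fun y => by rw [← hword, hm _ (natDegree_wordPolynomial_le y)]⟩

end Probability

end FiniteExchangeable

theorem mainTheorem4 {Ω : Type*} [MeasurableSpace Ω] (P : Measure Ω) [IsProbabilityMeasure P]
    (n : ℕ) (hn : 1 ≤ n) (X : Fin n → Ω → Fin 2) (hX : ∀ i, Measurable (X i))
    (hexch : FiniteExchangeable.Exchangeable P X) :
    FiniteExchangeable.IsTrueMixture (P.map (fun ω i => X i ω)) ↔
      (FiniteExchangeable.H n (FiniteExchangeable.x P X)).PosSemidef ∧
        (FiniteExchangeable.K n (FiniteExchangeable.x P X)).PosSemidef :=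
  hexch.isTrueMixture_map_iff hX
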